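/- Let $d\ge 1$, let $A$ be a diagonal $d\times d$ matrix with $a_{k,k}>0$ for all $k$, and let $\Omega=\{A\mathbf u:\mathbf u\in\mathbb S^{d-1}\}$ be the ellipsoid that it generates. Let $R$ be Weibull distributed with parameter $\beta\in(0,1)$ and scale $s>0$, i.e. $\mathbb P(R>x)=e^{-(x/s)^\beta}$ for $x\ge 0$, and let $\boldsymbol\Theta$ be a random vector with values in $\Omega$ such that $R\boldsymbol\Theta$ is integrable with $\mathbb E(R\boldsymbol\Theta)=\mathbf 0$ and, for every Borel set $S\subset\Omega$ of positive surface measure, $\mathbb P(\boldsymbol\Theta\in S)>0$ and $\lim_{x\to\infty}\mathbb P(\boldsymbol\Theta\in S\mid R>x)=\mathbb P(\boldsymbol\Theta\in S)$. Let $\mathbf X_1,\mathbf X_2,\dots$ be i.i.d. copies of $\mathbf X=R\boldsymbol\Theta$, put $\mathbf S_n=\mathbf X_1+\dots+\mathbf X_n$, and let $h$ be any function with $-\log\mathbb P(R>x)\sim h(x)$ as $x\to\infty$ (for instance $h(x)=(x/s)^\beta$). Then, for every $a>0$ and every $c>\max_{1\le j\le d}1/a_{j,j}$, the matrix $Q=I-A^{-1}/c$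 is a quota share strategy of a reinsurer who shares every line of business (it is diagonal with $0<q_{j,j}<1$ for all $j$), the probabilities below are positive for all large $n$, both limits below exist and are finite, and $$\lim_{n\to\infty}\frac{\log\mathbb P(\|\mathbf S_n/n\|_2>a)}{h(n)}>\lim_{n\to\infty}\frac{\log\mathbb P(\|(I-Q)\mathbf S_n/n\|_2>a)}{h(n)}.$$ -/

import Mathlib

open MeasureTheory ProbabilityTheory Filter Topology

/-- The ellipsoid `Λ(𝕊^{d-1})`, where `Λ x = A x`. -/
def ellipsoid {d : ℕ} (A : Matrix (Fin d) (Fin d) ℝ) : Set (EuclideanSpace ℝ (Fin d)) :=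
  Matrix.toEuclideanLin A '' Metric.sphere 0 1

/-- `R` is Weibull distributed with shape `β` and scale `s`:
`P(R > x) = exp (-(x / s) ^ β)` for every `x ≥ 0` (in particular `R > 0` almost surely). -/
def IsWeibull {Ω : Type*} [MeasurableSpace Ω] (μ : Measure Ω) (R : Ω → ℝ) (β s : ℝ) : Prop :=
  ∀ x : ℝ, 0 ≤ x → μ {ω | x < R ω} = ENNReal.ofReal (Real.exp (-(x / s) ^ β))

/-- The directional assumption on the pair `(R, Θ)`: `Θ` is distributed on the set `E` (an
ellipsoid), `R Θ` has mean zero, `Θ` charges every Borel subset of `E` of positive surface measure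
(the `(d-1)`-dimensional Hausdorff measure), and `Θ` is asymptotically independent of `R`. -/
structure IsAsympIndepOn {Ω : Type*} [MeasurableSpace Ω] {d : ℕ} (μ : Measure Ω) (R : Ω → ℝ)
    (Θ : Ω → EuclideanSpace ℝ (Fin d)) (E : Set (EuclideanSpace ℝ (Fin d))) : Prop where
  mem : ∀ᵐ ω ∂μ, Θ ω ∈ E
  integrable : Integrable (fun ω => R ω • Θ ω) μ
  mean_zero : ∫ ω, R ω • Θ ω ∂μ = 0
  pos : ∀ S : Set (EuclideanSpace ℝ (Fin d)), S ⊆ E → MeasurableSet S →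
    0 < Measure.hausdorffMeasure ((d : ℝ) - 1) S → 0 < μ (Θ ⁻¹' S)
  asymp_indep : ∀ S : Set (EuclideanSpace ℝ (Fin d)), S ⊆ E → MeasurableSet S →
    0 < Measure.hausdorffMeasure ((d : ℝ) - 1) S →
    Tendsto (fun x : ℝ => ProbabilityTheory.cond μ {ω | x < R ω} (Θ ⁻¹' S)) atTop
      (𝓝 (μ (Θ ⁻¹' S)))

/-- A quota share strategy in which reinsurance is offered for every line of business:
a diagonal matrix with diagonal entries in `(0, 1)`. -/
def IsReinsurerStrategy {d : ℕ} (Q : Matrix (Fin d) (Fin d) ℝ) : Prop :=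
  Q.IsDiag ∧ ∀ j, 0 < Q j j ∧ Q j j < 1

/-- The random walk `S_n = X_1 + ⋯ + X_n`; the increments are indexed from `0`. -/
def randomWalk {Ω : Type*} {d : ℕ} (X : ℕ → Ω → EuclideanSpace ℝ (Fin d)) (n : ℕ) (ω : Ω) :
    EuclideanSpace ℝ (Fin d) :=
  ∑ i ∈ Finset.range n, X i ω

/-- The probability `P(‖M S_n / n‖₂ > a)`. -/
noncomputable def exceedProb {Ω : Type*} [MeasurableSpace Ω] {d : ℕ} (μ : Measure Ω)
    (X : ℕ → Ω → EuclideanSpace ℝ (Fin d)) (M : Matrix (Fin d) (Fin d) ℝ) (a : ℝ) (n : ℕ) : ℝ :=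
  μ.real {ω | a < ‖Matrix.toEuclideanLin M ((n : ℝ)⁻¹ • randomWalk X n ω)‖}

/-! The proof is the principle of one big jump. Put `m` for the maximum of `‖M x‖` over the
ellipsoid, assumed to be attained at a vertex `A j j` on the `j`-th axis. Then `log P(‖M S_n / n‖ >
a)` is asymptotic to `-(a / m) ^ β * (n / s) ^ β`: as `β < 1`, the cheapest way for the sum to
exceed `a n` is a single increment with `R > a n / m` and direction near the vertex. This is
`tendsto_log_exceedProb`.

The upper bound reduces the norm to finitely many linear functionals, and for each uses truncation
and Chernoff's bound (`IsWeibull.measureReal_sum_gt_le`). The lower bound makes one increment large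
while the law of large numbers controls the others (`eventually_exp_le_measureReal_norm_sum_gt`).
Asymptotic independence makes the choice of direction cost only a constant factor.

For `M = 1`, `m` is the longest semi-axis. For `M = 1 - Q`, the ellipsoid becomes the sphere of
radius `1 / c`, so `m = 1 / c`, which is strictly smaller. Hence the strict inequality between the
limits. -/

theorem exp_le_one_add_add_sq_mul_exp {x y : ℝ} (hxy : x ≤ y) (hy : 0 ≤ y) :
    Real.exp x ≤ 1 + x + x ^ 2 * Real.exp y := by
  have h1 : 1 ≤ Real.exp y := Real.one_le_exp hy
  -- Taylor's bound settles `|x| ≤ 1`. Beyond that `1 ≤ x ^ 2`, and the last term alone makes up for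
  -- the rest.
  rcases le_or_gt |x| 1 with h | h
  · have := (abs_le.1 (Real.abs_exp_sub_one_sub_id_le h)).2
    nlinarith [sq_nonneg x]
  · have hsq : 1 ≤ x ^ 2 := by
      rw [← sq_abs]; nlinarith
    rcases le_or_gt x 0 with hx | hx
    · rw [abs_of_nonpos hx] at h
      have : Real.exp x ≤ 1 := Real.exp_le_one_iff.2 hx
      nlinarith
    · have : Real.exp x ≤ Real.exp y := Real.exp_le_exp.2 hxy
      nlinarith [Real.exp_pos y]

/-! ### Exponential moments of Weibull variables and truncated sums -/

namespace IsWeibull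

variable {Ω : Type*} [MeasurableSpace Ω] {μ : Measure Ω} {R : Ω → ℝ} {β s : ℝ}

theorem measureReal_lt (h : IsWeibull μ R β s) {x : ℝ} (hx : 0 ≤ x) :
    μ.real {ω | x < R ω} = Real.exp (-(x / s) ^ β) := by
  rw [Measure.real, h x hx, ENNReal.toReal_ofReal (Real.exp_pos _).le]

theorem ae_pos [IsProbabilityMeasure μ] (h : IsWeibull μ R β s) (hR : Measurable R)
    (hβ : 0 < β) : ∀ᵐ ω ∂μ, 0 < R ω := by
  have h0 := h 0 le_rfl
  rw [zero_div, Real.zero_rpow hβ.ne', neg_zero, Real.exp_zero, ENNReal.ofReal_one] at h0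
  rw [← prob_compl_eq_zero_iff (measurableSet_lt measurable_const hR)] at h0
  exact h0

/-- By the layer cake formula: for `t > 1` the tail at `t` is at most `t ^ (-1 / q)`, which is
integrable at infinity because `1 / q > 1`. -/
theorem integrable_exp_mul_rpow [IsProbabilityMeasure μ] (h : IsWeibull μ R β s)
    (hR : Measurable R) (hβ : 0 < β) (hs : 0 < s) {q : ℝ} (hq0 : 0 < q) (hq1 : q < 1) :
    Integrable (fun ω => Real.exp (q * (R ω / s) ^ β)) μ := by
  have hm : Measurable (fun ω => Real.exp (q * (R ω / s) ^ β)) := by fun_prop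
  refine ⟨hm.aestronglyMeasurable, ?_⟩
  rw [hasFiniteIntegral_iff_ofReal (ae_of_all _ fun _ => (Real.exp_pos _).le),
    lintegral_eq_lintegral_meas_lt _ (ae_of_all _ fun _ => (Real.exp_pos _).le) hm.aemeasurable,
    ← Set.Ioc_union_Ioi_eq_Ioi zero_le_one]
  refine (lintegral_union_le _ _ _).trans_lt (ENNReal.add_lt_top.2 ⟨?_, ?_⟩)
  · calc ∫⁻ t in Set.Ioc (0 : ℝ) 1, μ {ω | t < Real.exp (q * (R ω / s) ^ β)}
        ≤ ∫⁻ _ in Set.Ioc (0 : ℝ) 1, 1 := lintegral_mono fun _ => prob_le_one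
      _ < ⊤ := by simp
  · have key : ∀ t ∈ Set.Ioi (1 : ℝ), μ {ω | t < Real.exp (q * (R ω / s) ^ β)}
        ≤ ENNReal.ofReal (t ^ (-q⁻¹)) := by
      intro t ht
      have ht1 : (1 : ℝ) < t := ht
      have hl : 0 ≤ Real.log t / q := div_nonneg (Real.log_nonneg ht1.le) hq0.le
      have hx : 0 ≤ s * (Real.log t / q) ^ β⁻¹ := by positivity
      have e : Real.exp (-(s * (Real.log t / q) ^ β⁻¹ / s) ^ β) = t ^ (-q⁻¹) := by
        rw [mul_div_cancel_left₀ _ hs.ne', Real.rpow_inv_rpow hl hβ.ne',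
          Real.rpow_def_of_pos (by linarith)]
        congr 1; ring
      rw [← e, ← h _ hx]
      refine measure_mono_ae ?_
      filter_upwards [h.ae_pos hR hβ] with ω hω hlt
      change t < _ at hlt
      change s * (Real.log t / q) ^ β⁻¹ < R ω
      have h1 : Real.log t / q < (R ω / s) ^ β := by
        rw [div_lt_iff₀ hq0, mul_comm]
        exact (Real.log_lt_iff_lt_exp (by linarith)).2 hlt
      have h2 := (Real.rpow_inv_lt_iff_of_pos hl (by positivity) hβ).2 h1
      rwa [lt_div_iff₀ hs, mul_comm] at h2
    refine (setLIntegral_mono' measurableSet_Ioi key).trans_lt ?_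
    have hi : IntegrableOn (fun t : ℝ => t ^ (-q⁻¹)) (Set.Ioi 1) :=
      integrableOn_Ioi_rpow_of_lt (by
        have := (one_lt_inv₀ hq0).2 hq1
        linarith) one_pos
    exact hi.lintegral_lt_top

/-- The square is absorbed by the room between `q` and some `r < 1`. -/
theorem integrable_sq_mul_exp_mul_rpow [IsProbabilityMeasure μ] (h : IsWeibull μ R β s)
    (hR : Measurable R) (hβ : 0 < β) (hs : 0 < s) {q : ℝ} (hq0 : 0 < q) (hq1 : q < 1) :
    Integrable (fun ω => R ω ^ 2 * Real.exp (q * (R ω / s) ^ β)) μ := by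
  obtain ⟨r, hqr, hr1⟩ := exists_between hq1
  set ε := r - q with hε
  have hε0 : 0 < ε := by linarith
  -- With `k * β ≥ 2`, `x ^ 2 ≤ (x ^ β) ^ k` for `x > 1`, and a power of `x ^ β` is dominated by its
  -- exponential series.
  obtain ⟨k, hk⟩ := exists_nat_ge (2 / β)
  have hi := (h.integrable_exp_mul_rpow hR hβ hs (hq0.trans hqr) hr1).const_mul
    (s ^ 2 * (1 + k.factorial / ε ^ k))
  refine hi.mono' (by fun_prop) ?_
  filter_upwards [h.ae_pos hR hβ] with ω hω
  have hx : 0 < R ω / s := by positivity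
  set x := R ω / s with hxd
  have hRx : R ω = s * x := by rw [hxd]; field_simp
  rw [Real.norm_of_nonneg (by positivity), hRx]
  have hu : 0 ≤ x ^ β := by positivity
  have e1 : Real.exp (r * x ^ β) = Real.exp (ε * x ^ β) * Real.exp (q * x ^ β) := by
    rw [← Real.exp_add]; congr 1; rw [hε]; ring
  have hexp1 : 1 ≤ Real.exp (ε * x ^ β) := Real.one_le_exp (by positivity)
  have hk1 : (x ^ β) ^ k ≤ k.factorial / ε ^ k * Real.exp (ε * x ^ β) := by
    have := Real.pow_div_factorial_le_exp (ε * x ^ β) (by positivity) k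
    rw [div_le_iff₀ (by positivity), mul_pow] at this
    rw [div_mul_eq_mul_div, le_div_iff₀ (by positivity)]
    linarith
  have hx2 : x ^ 2 ≤ (1 + k.factorial / ε ^ k) * Real.exp (ε * x ^ β) := by
    rcases le_or_gt x 1 with h1 | h1
    · have : 0 ≤ k.factorial / ε ^ k * Real.exp (ε * x ^ β) := by positivity
      nlinarith
    · have : x ^ 2 ≤ (x ^ β) ^ k := by
        rw [← Real.rpow_natCast, ← Real.rpow_natCast, ← Real.rpow_mul hx.le]
        apply Real.rpow_le_rpow_of_exponent_le h1.le
        rw [div_le_iff₀ hβ] at hk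
        push_cast; linarith
      nlinarith
  rw [e1]
  calc (s * x) ^ 2 * Real.exp (q * x ^ β) = s ^ 2 * Real.exp (q * x ^ β) * x ^ 2 := by ring
    _ ≤ s ^ 2 * Real.exp (q * x ^ β) *
        ((1 + k.factorial / ε ^ k) * Real.exp (ε * x ^ β)) := by gcongr
    _ = _ := by ring

/-- The Laplace transform of a truncated variable dominated by a Weibull variable. -/
theorem mgf_min_le [IsProbabilityMeasure μ] (h : IsWeibull μ R β s) (hR : Measurable R)
    (hβ : β ∈ Set.Ioo (0 : ℝ) 1) (hs : 0 < s) {m : ℝ} (hm : 0 < m) {q : ℝ} (hq0 : 0 < q)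
    (hq1 : q < 1) {Z : Ω → ℝ} (hZ : Integrable Z μ) (hZ0 : ∫ ω, Z ω ∂μ ≤ 0)
    (hZR : ∀ᵐ ω ∂μ, |Z ω| ≤ m * R ω) {t : ℝ} (ht : 0 < t) :
    Integrable (fun ω => Real.exp (q * (t / (m * s)) ^ β / t * min (Z ω) t)) μ ∧
    mgf (fun ω => min (Z ω) t) μ (q * (t / (m * s)) ^ β / t) ≤
      Real.exp ((q * (t / (m * s)) ^ β / t) ^ 2 *
        ∫ ω, m ^ 2 * (R ω ^ 2 * Real.exp (q * (R ω / s) ^ β)) ∂μ) := by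
  -- The line of slope `θ` meets the curve `q * (w / (m * s)) ^ β` at `w = t`. Since `β < 1`, it
  -- lies below the curve for `0 < w ≤ t`, so the exponential moment of the truncated variable is
  -- controlled uniformly in `t`.
  set θ := q * (t / (m * s)) ^ β / t with hθ
  have hθ0 : 0 < θ := by positivity
  have hW : Integrable (fun ω => min (Z ω) t) μ := hZ.inf (integrable_const t)
  have hI := (h.integrable_sq_mul_exp_mul_rpow hR hβ.1 hs hq0 hq1).const_mul (m ^ 2)
  have hint : Integrable (fun ω => 1 + θ * min (Z ω) t +
      θ ^ 2 * (m ^ 2 * (R ω ^ 2 * Real.exp (q * (R ω / s) ^ β)))) μ :=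
    ((integrable_const _).add (hW.const_mul θ)).add (hI.const_mul (θ ^ 2))
  have hpt : ∀ᵐ ω ∂μ, Real.exp (θ * min (Z ω) t) ≤ 1 + θ * min (Z ω) t +
      θ ^ 2 * (m ^ 2 * (R ω ^ 2 * Real.exp (q * (R ω / s) ^ β))) := by
    filter_upwards [h.ae_pos hR hβ.1, hZR] with ω hω hz
    have hle : θ * min (Z ω) t ≤ q * (R ω / s) ^ β := by
      rcases le_or_gt (min (Z ω) t) 0 with h0 | h0
      · exact (mul_nonpos_of_nonneg_of_nonpos hθ0.le h0).trans (by positivity)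
      · set w := min (Z ω) t with hw
        have hwR : w ≤ m * R ω := (min_le_left _ _).trans ((le_abs_self _).trans hz)
        have h1 : w / t ≤ (w / t) ^ β := by
          have := Real.rpow_le_rpow_of_exponent_ge (x := w / t) (by positivity)
            ((div_le_one ht).2 (min_le_right _ _)) hβ.2.le
          rwa [Real.rpow_one] at this
        calc θ * w = q * (t / (m * s)) ^ β * (w / t) := by rw [hθ]; ring
          _ ≤ q * (t / (m * s)) ^ β * (w / t) ^ β := by gcongr
          _ = q * (w / (m * s)) ^ β := by
            rw [mul_assoc, ← Real.mul_rpow (by positivity) (by positivity)]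
            congr 2; field_simp
          _ ≤ q * (R ω / s) ^ β := by
            gcongr q * ?_
            apply Real.rpow_le_rpow (by positivity) _ hβ.1.le
            rw [div_le_div_iff₀ (by positivity) hs]
            nlinarith
    refine (exp_le_one_add_add_sq_mul_exp hle (by positivity)).trans ?_
    have hsq : (min (Z ω) t) ^ 2 ≤ (m * R ω) ^ 2 := by
      apply sq_le_sq'
      · exact le_min (by linarith [neg_abs_le (Z ω)]) (by nlinarith [mul_pos hm hω])
      · exact (min_le_left _ _).trans ((le_abs_self _).trans hz)
    have : (θ * min (Z ω) t) ^ 2 * Real.exp (q * (R ω / s) ^ β) ≤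
        θ ^ 2 * (m ^ 2 * (R ω ^ 2 * Real.exp (q * (R ω / s) ^ β))) := by
      calc _ = θ ^ 2 * Real.exp (q * (R ω / s) ^ β) * (min (Z ω) t) ^ 2 := by ring
        _ ≤ θ ^ 2 * Real.exp (q * (R ω / s) ^ β) * (m * R ω) ^ 2 := by gcongr
        _ = _ := by ring
    linarith
  have hexp : Integrable (fun ω => Real.exp (θ * min (Z ω) t)) μ := by
    refine hint.mono' ?_ ?_
    · exact Real.continuous_exp.comp_aestronglyMeasurable
        (hW.aestronglyMeasurable.const_mul θ)
    · filter_upwards [hpt] with ω hω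
      rwa [Real.norm_of_nonneg (Real.exp_pos _).le]
  refine ⟨hexp, ?_⟩
  calc mgf (fun ω => min (Z ω) t) μ θ
      ≤ ∫ ω, (1 + θ * min (Z ω) t +
        θ ^ 2 * (m ^ 2 * (R ω ^ 2 * Real.exp (q * (R ω / s) ^ β)))) ∂μ :=
        integral_mono_ae hexp hint hpt
    _ = 1 + θ * ∫ ω, min (Z ω) t ∂μ +
        θ ^ 2 * ∫ ω, m ^ 2 * (R ω ^ 2 * Real.exp (q * (R ω / s) ^ β)) ∂μ := by
      have hadd : Integrable (fun ω => 1 + θ * min (Z ω) t) μ :=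
        (integrable_const _).add (hW.const_mul θ)
      rw [integral_add hadd (hI.const_mul (θ ^ 2)),
        integral_add (integrable_const _) (hW.const_mul θ), integral_const_mul,
        integral_const_mul]
      simp
    _ ≤ 1 + θ ^ 2 * ∫ ω, m ^ 2 * (R ω ^ 2 * Real.exp (q * (R ω / s) ^ β)) ∂μ := by
      -- Truncation from above only lowers the mean, so the linear term is nonpositive and only the
      -- quadratic one remains.
      have : ∫ ω, min (Z ω) t ∂μ ≤ ∫ ω, Z ω ∂μ :=
        integral_mono hW hZ fun _ => min_le_left _ _
      nlinarith
    _ ≤ _ := by rw [add_comm]; exact Real.add_one_le_exp _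

/-- Union bound on one large summand, and Chernoff's bound on the truncated sum. -/
theorem measureReal_sum_gt_le [IsProbabilityMeasure μ] (h : IsWeibull μ R β s)
    (hR : Measurable R)
    (hβ : β ∈ Set.Ioo (0 : ℝ) 1) (hs : 0 < s) {m : ℝ} (hm : 0 < m) {q : ℝ} (hq0 : 0 < q)
    (hq1 : q < 1) {Z : Ω → ℝ} (hZ : Integrable Z μ) (hZ0 : ∫ ω, Z ω ∂μ ≤ 0)
    (hZR : ∀ᵐ ω ∂μ, |Z ω| ≤ m * R ω) {Y : ℕ → Ω → ℝ} (hY : iIndepFun Y μ)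
    (hYZ : ∀ i, IdentDistrib (Y i) Z μ μ) {t : ℝ} (ht : 0 < t) (n : ℕ) :
    μ.real {ω | t < ∑ i ∈ Finset.range n, Y i ω} ≤
      n * Real.exp (-(t / (m * s)) ^ β) +
      Real.exp (-(q * (t / (m * s)) ^ β) + n * ((q * (t / (m * s)) ^ β / t) ^ 2 *
        ∫ ω, m ^ 2 * (R ω ^ 2 * Real.exp (q * (R ω / s) ^ β)) ∂μ)) := by
  obtain ⟨hexp, hmgf⟩ := h.mgf_min_le hR hβ hs hm hq0 hq1 hZ hZ0 hZR ht
  set θ := q * (t / (m * s)) ^ β / t with hθ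
  have hθ0 : 0 < θ := by positivity
  have hmin : Measurable (fun x : ℝ => min x t) := measurable_id.min measurable_const
  have hWid : ∀ i, IdentDistrib (fun ω => min (Y i ω) t) (fun ω => min (Z ω) t) μ μ :=
    fun i => (hYZ i).comp hmin
  have hWind : iIndepFun (fun i ω => min (Y i ω) t) μ := hY.comp (fun _ x => min x t) fun _ => hmin
  have hbig : ∀ i, μ.real {ω | t < Y i ω} ≤ Real.exp (-(t / (m * s)) ^ β) := by
    intro i
    have e1 : μ.real {ω | t < Y i ω} = μ.real {ω | t < Z ω} := by
      unfold Measure.real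
      congr 1
      exact (hYZ i).measure_mem_eq (s := Set.Ioi t) measurableSet_Ioi
    have e2 : t / (m * s) = t / m / s := by field_simp
    rw [e1, e2, ← h.measureReal_lt (div_nonneg ht.le hm.le)]
    refine ENNReal.toReal_mono (measure_ne_top _ _) (measure_mono_ae ?_)
    filter_upwards [hZR] with ω hω hlt
    change t < Z ω at hlt
    change t / m < R ω
    rw [div_lt_iff₀ hm]
    linarith [le_abs_self (Z ω)]
  have hsub : {ω | t < ∑ i ∈ Finset.range n, Y i ω} ⊆
      (⋃ i ∈ Finset.range n, {ω | t < Y i ω}) ∪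
        {ω | t ≤ (∑ i ∈ Finset.range n, fun ω => min (Y i ω) t) ω} := by
    intro ω hω
    by_cases hc : ∃ i ∈ Finset.range n, t < Y i ω
    · left; simpa using hc
    · right
      push Not at hc
      change t ≤ _
      rw [Finset.sum_apply, Finset.sum_congr rfl fun i hi => min_eq_left (hc i hi)]
      exact le_of_lt hω
  refine (measureReal_mono hsub).trans ((measureReal_union_le _ _).trans (add_le_add ?_ ?_))
  · refine (measureReal_biUnion_finset_le _ _).trans ((Finset.sum_le_sum fun i _ => hbig i).trans ?_)
    simp
  · have hms : mgf (∑ i ∈ Finset.range n, fun ω => min (Y i ω) t) μ θ =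
        mgf (fun ω => min (Z ω) t) μ θ ^ n := by
      rw [hWind.mgf_sum₀ fun i => (hWid i).aemeasurable_fst,
        Finset.prod_eq_pow_card fun i _ => mgf_congr_of_identDistrib _ _ (hWid i) θ,
        Finset.card_range]
    have hintsum : Integrable
        (fun ω => Real.exp (θ * (∑ i ∈ Finset.range n, fun ω => min (Y i ω) t) ω)) μ := by
      refine integrable_exp_mul_of_le θ (n * t) hθ0.le
        (Finset.aemeasurable_sum _ fun i _ => (hWid i).aemeasurable_fst) (ae_of_all _ fun ω => ?_)
      rw [Finset.sum_apply]
      refine (Finset.sum_le_sum fun i _ => min_le_right (Y i ω) t).trans ?_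
      simp
    refine (measure_ge_le_exp_mul_mgf t hθ0.le hintsum).trans ?_
    rw [hms, Real.exp_add, Real.exp_nat_mul]
    have e3 : -θ * t = -(q * (t / (m * s)) ^ β) := by rw [hθ]; field_simp
    rw [e3]
    gcongr
    exact mgf_nonneg

end IsWeibull

/-! ### Growth of the scale `(n / s) ^ β` -/

section Growth

variable {β s : ℝ}

theorem tendsto_div_rpow_atTop (hβ : 0 < β) (hs : 0 < s) :
    Tendsto (fun n : ℕ => ((n : ℝ) / s) ^ β) atTop atTop :=
  (tendsto_rpow_atTop hβ).comp (tendsto_natCast_atTop_atTop.atTop_div_const hs)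

theorem tendsto_div_rpow_div_nhds_zero (hβ : β < 1) (hs : 0 < s) :
    Tendsto (fun n : ℕ => ((n : ℝ) / s) ^ β / n) atTop (𝓝 0) := by
  have h1 : Tendsto (fun n : ℕ => ((n : ℝ) / s) ^ (-(1 - β)) * s⁻¹) atTop (𝓝 (0 * s⁻¹)) :=
    ((tendsto_rpow_neg_atTop (by linarith : 0 < 1 - β)).comp
      (tendsto_natCast_atTop_atTop.atTop_div_const hs)).mul_const _
  rw [zero_mul] at h1
  refine h1.congr' ?_
  filter_upwards [eventually_gt_atTop 0] with n hn
  have hn' : (0 : ℝ) < n := by exact_mod_cast hn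
  have : -(1 - β) = β - 1 := by ring
  rw [this, Real.rpow_sub_one (by positivity)]
  field_simp

theorem eventually_const_mul_le_exp_mul_rpow (hβ : 0 < β) (hs : 0 < s) (K : ℝ) {ε : ℝ}
    (hε : 0 < ε) : ∀ᶠ n : ℕ in atTop, K * ((n : ℝ) + 1) ≤ Real.exp (ε * ((n : ℝ) / s) ^ β) := by
  have hw := tendsto_div_rpow_atTop hβ hs
  -- In terms of `w = (n / s) ^ β`, `n = s * w ^ (1 / β)` is a power of `w`, hence negligible
  -- against `exp (ε * w)`.
  have h1 := (tendsto_rpow_mul_exp_neg_mul_atTop_nhds_zero β⁻¹ ε hε).comp hw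
  have h2 := (tendsto_rpow_mul_exp_neg_mul_atTop_nhds_zero 0 ε hε).comp hw
  have h3 := ((h1.const_mul s).add h2).const_mul K
  rw [mul_zero, add_zero, mul_zero] at h3
  filter_upwards [h3.eventually (eventually_le_nhds one_pos)] with n hn
  simp only [Function.comp_apply, Real.rpow_zero, one_mul] at hn
  rw [Real.rpow_rpow_inv (by positivity) hβ.ne', ← mul_assoc s, mul_div_cancel₀ _ hs.ne'] at hn
  have h4 : Real.exp (-ε * ((n : ℝ) / s) ^ β) * Real.exp (ε * ((n : ℝ) / s) ^ β) = 1 := by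
    rw [← Real.exp_add]; simp
  calc K * ((n : ℝ) + 1) = K * (n * Real.exp (-ε * ((n : ℝ) / s) ^ β) +
        Real.exp (-ε * ((n : ℝ) / s) ^ β)) * Real.exp (ε * ((n : ℝ) / s) ^ β) := by
        linear_combination -K * (n + 1) * h4
    _ ≤ 1 * Real.exp (ε * ((n : ℝ) / s) ^ β) := by gcongr
    _ = _ := one_mul _

/-- Prefactors at most linear in `n` cost nothing on this scale; this absorbs the union bounds and
the constants of the lower bound. -/
theorem eventually_const_mul_exp_le_exp (hβ : 0 < β) (hs : 0 < s) (K : ℝ) {ρ ρ' : ℝ}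
    (hρ : ρ < ρ') : ∀ᶠ n : ℕ in atTop,
      K * ((n : ℝ) + 1) * Real.exp (-(ρ' * ((n : ℝ) / s) ^ β)) ≤
        Real.exp (-(ρ * ((n : ℝ) / s) ^ β)) := by
  filter_upwards [eventually_const_mul_le_exp_mul_rpow hβ hs K (sub_pos.2 hρ)] with n hn
  calc _ ≤ Real.exp ((ρ' - ρ) * ((n : ℝ) / s) ^ β) * Real.exp (-(ρ' * ((n : ℝ) / s) ^ β)) := by
        gcongr
    _ = _ := by rw [← Real.exp_add]; congr 1; ring

end Growth

/-- A finite family of functionals of norm at most one that almost recovers the norm. -/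
theorem exists_finset_forall_exists_mul_norm_le_inner {F : Type*} [NormedAddCommGroup F]
    [InnerProductSpace ℝ F] [FiniteDimensional ℝ F] {ε : ℝ} (hε : 0 < ε) :
    ∃ N : Finset F, (∀ v ∈ N, ‖v‖ ≤ 1) ∧ ∀ x : F, ∃ v ∈ N, (1 - ε) * ‖x‖ ≤ inner ℝ v x := by
  obtain ⟨t, ht, hfin, hcov⟩ := (isCompact_closedBall (0 : F) 1).finite_cover_balls hε
  refine ⟨hfin.toFinset, fun v hv => ?_, fun x => ?_⟩
  · simpa using ht (hfin.mem_toFinset.1 hv)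
  · have hu : ‖x‖⁻¹ • x ∈ Metric.closedBall (0 : F) 1 := by
      rw [mem_closedBall_zero_iff, norm_smul, norm_inv, norm_norm]
      exact inv_mul_le_one
    obtain ⟨v, hv, hvx⟩ := Set.mem_iUnion₂.1 (hcov hu)
    refine ⟨v, hfin.mem_toFinset.2 hv, ?_⟩
    rw [Metric.mem_ball, dist_eq_norm] at hvx
    have h1 : inner ℝ (‖x‖⁻¹ • x - v) x ≤ ε * ‖x‖ :=
      (real_inner_le_norm _ _).trans (by gcongr)
    have h2 : inner ℝ (‖x‖⁻¹ • x) x = ‖x‖ := by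
      rcases eq_or_ne x 0 with rfl | hx
      · simp
      · rw [real_inner_smul_left, real_inner_self_eq_norm_sq]
        have := norm_ne_zero_iff.2 hx
        field_simp
    rw [inner_sub_left, h2] at h1
    linarith

/-! ### Upper bound for the sums -/

namespace IsWeibull

variable {Ω : Type*} [MeasurableSpace Ω] {μ : Measure Ω} [IsProbabilityMeasure μ] {R : Ω → ℝ}
  {β s m : ℝ}

theorem eventually_measureReal_sum_gt_le (h : IsWeibull μ R β s) (hR : Measurable R)
    (hβ : β ∈ Set.Ioo (0 : ℝ) 1) (hs : 0 < s) (hm : 0 < m)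
    {Z : Ω → ℝ} (hZ : Integrable Z μ) (hZ0 : ∫ ω, Z ω ∂μ ≤ 0)
    (hZR : ∀ᵐ ω ∂μ, |Z ω| ≤ m * R ω) {Y : ℕ → Ω → ℝ} (hY : iIndepFun Y μ)
    (hYZ : ∀ i, IdentDistrib (Y i) Z μ μ) {b : ℝ} (hb : 0 < b) {ρ : ℝ} (hρ : ρ < (b / m) ^ β) :
    ∀ᶠ n : ℕ in atTop, μ.real {ω | b * n < ∑ i ∈ Finset.range n, Y i ω} ≤
      Real.exp (-(ρ * ((n : ℝ) / s) ^ β)) := by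
  have hB : 0 < (b / m) ^ β := by positivity
  -- The maximum with `0` is needed because `ρ` may be negative while `q` must be positive. The gap
  -- from `ρ₁` to `ρ₂` will absorb the quadratic Chernoff term, and the gap from `ρ` to `ρ₁` the
  -- factor `n + 1`.
  obtain ⟨ρ₁, hρ₁, hρ₁B⟩ := exists_between (max_lt hρ hB)
  obtain ⟨ρ₂, hρ₁₂, hρ₂⟩ := exists_between hρ₁B
  have hρ₁0 : 0 < ρ₁ := (le_max_right _ _).trans_lt hρ₁
  have hρ₂0 : 0 < ρ₂ := hρ₁0.trans hρ₁₂
  set q := ρ₂ / (b / m) ^ β with hq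
  have hq0 : 0 < q := by positivity
  have hq1 : q < 1 := (div_lt_one hB).2 hρ₂
  set C := ∫ ω, m ^ 2 * (R ω ^ 2 * Real.exp (q * (R ω / s) ^ β)) ∂μ with hC
  -- With `t = b * n`, the quadratic term is `w` times a constant multiple of `w / n`, where `w = (n
  -- / s) ^ β`. It is `o(w)` because `β < 1`.
  have hsmall := ((tendsto_div_rpow_div_nhds_zero hβ.2 hs).const_mul (ρ₂ ^ 2 / b ^ 2 * C))
  rw [mul_zero] at hsmall
  filter_upwards [hsmall.eventually (eventually_le_nhds (sub_pos.2 hρ₁₂)),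
    eventually_const_mul_exp_le_exp hβ.1 hs 1 ((le_max_left _ _).trans_lt hρ₁),
    eventually_gt_atTop 0] with n hn1 hn2 hn0
  have hn' : (0 : ℝ) < n := by exact_mod_cast hn0
  set w := ((n : ℝ) / s) ^ β with hw
  have hw0 : 0 < w := by positivity
  have hBw : (b * n / (m * s)) ^ β = (b / m) ^ β * w := by
    rw [hw, ← Real.mul_rpow (by positivity) (by positivity)]
    congr 1; field_simp
  have hqB : q * ((b / m) ^ β * w) = ρ₂ * w := by rw [hq]; field_simp
  refine (h.measureReal_sum_gt_le hR hβ hs hm hq0 hq1 hZ hZ0 hZR hY hYZ (t := b * n)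
    (by positivity) n).trans ?_
  rw [hBw, hqB, ← hC]
  have e1 : Real.exp (-((b / m) ^ β * w)) ≤ Real.exp (-(ρ₁ * w)) := by gcongr
  have e2 : Real.exp (-(ρ₂ * w) + n * ((ρ₂ * w / (b * n)) ^ 2 * C)) ≤ Real.exp (-(ρ₁ * w)) := by
    gcongr
    have : n * ((ρ₂ * w / (b * n)) ^ 2 * C) = w * (ρ₂ ^ 2 / b ^ 2 * C * (w / n)) := by
      field_simp
    rw [this]
    nlinarith
  refine le_trans ?_ hn2
  have := mul_le_mul_of_nonneg_left e1 hn'.le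
  linarith

variable {F : Type*} [NormedAddCommGroup F] [InnerProductSpace ℝ F] [FiniteDimensional ℝ F]
  [MeasurableSpace F] [BorelSpace F] {V : Ω → F} {Y : ℕ → Ω → F}

/-- Some functional in a finite net recovers the norm up to the factor `b / a`. Taking `b < a` close
to `a` keeps the rate above `ρ`, and the union over the net is a constant factor. -/
theorem eventually_measureReal_norm_sum_gt_le (h : IsWeibull μ R β s) (hR : Measurable R)
    (hβ : β ∈ Set.Ioo (0 : ℝ) 1) (hs : 0 < s) (hm : 0 < m)
    (hV : Integrable V μ) (hV0 : ∫ ω, V ω ∂μ = 0)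
    (hVR : ∀ᵐ ω ∂μ, ‖V ω‖ ≤ m * R ω) (hY : iIndepFun Y μ)
    (hYV : ∀ i, IdentDistrib (Y i) V μ μ) {a : ℝ} (ha : 0 < a) {ρ : ℝ} (hρ : ρ < (a / m) ^ β) :
    ∀ᶠ n : ℕ in atTop, μ.real {ω | a * n < ‖∑ i ∈ Finset.range n, Y i ω‖} ≤
      Real.exp (-(ρ * ((n : ℝ) / s) ^ β)) := by
  have hcont : ContinuousAt (fun b : ℝ => (b / m) ^ β) a :=
    (continuousAt_id.div_const m).rpow_const (Or.inr hβ.1.le)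
  obtain ⟨b, ⟨hb, hb0⟩, hba⟩ := (((hcont.eventually (lt_mem_nhds hρ)).and
    (lt_mem_nhds ha)).filter_mono nhdsWithin_le_nhds |>.and
      (self_mem_nhdsWithin : Set.Iio a ∈ 𝓝[<] a)).exists
  obtain ⟨ρ₁, hρ₁, hρ₁b⟩ := exists_between hb
  have hε : 0 < 1 - b / a := sub_pos.2 ((div_lt_one ha).2 hba)
  obtain ⟨N, hN1, hN⟩ := exists_finset_forall_exists_mul_norm_le_inner (F := F) hε
  have hall : ∀ᶠ n : ℕ in atTop, ∀ v ∈ N,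
      μ.real {ω | b * n < ∑ i ∈ Finset.range n, inner ℝ v (Y i ω)} ≤
      Real.exp (-(ρ₁ * ((n : ℝ) / s) ^ β)) := by
    rw [Filter.eventually_all_finset]
    intro v hv
    have hmeas : Measurable (fun x : F => (inner ℝ v x : ℝ)) := by fun_prop
    refine h.eventually_measureReal_sum_gt_le hR hβ hs hm (Z := fun ω => inner ℝ v (V ω))
      (hV.const_inner v) ?_ ?_ (hY.comp (fun _ x => inner ℝ v x) fun _ => hmeas)
      (fun i => (hYV i).comp hmeas) hb0 hρ₁b
    · rw [integral_inner hV, hV0, inner_zero_right]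
    · filter_upwards [hVR] with ω hω
      refine (abs_real_inner_le_norm _ _).trans (le_trans ?_ hω)
      exact mul_le_of_le_one_left (norm_nonneg _) (hN1 v hv)
  filter_upwards [hall, eventually_const_mul_exp_le_exp hβ.1 hs (N.card : ℝ) hρ₁]
    with n hn hn2
  have hsub : {ω | a * n < ‖∑ i ∈ Finset.range n, Y i ω‖} ⊆
      ⋃ v ∈ N, {ω | b * n < ∑ i ∈ Finset.range n, inner ℝ v (Y i ω)} := by
    intro ω hω
    change a * n < _ at hω
    obtain ⟨v, hv, hle⟩ := hN (∑ i ∈ Finset.range n, Y i ω)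
    refine Set.mem_iUnion₂.2 ⟨v, hv, ?_⟩
    change b * n < _
    rw [← inner_sum]
    refine lt_of_lt_of_le ?_ hle
    calc b * n = b / a * (a * n) := by field_simp
      _ < b / a * ‖∑ i ∈ Finset.range n, Y i ω‖ := by gcongr
      _ = _ := by ring
  refine (measureReal_mono hsub (measure_ne_top _ _)).trans ((measureReal_biUnion_finset_le _ _).trans
    ((Finset.sum_le_sum hn).trans (le_trans ?_ hn2)))
  rw [Finset.sum_const, nsmul_eq_mul]
  gcongr
  exact le_mul_of_one_le_right (by positivity) (by linarith [(Nat.cast_nonneg n : (0 : ℝ) ≤ n)])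

end IsWeibull

/-! ### Lower bound by one big jump -/

section LowerBound

variable {Ω : Type*} [MeasurableSpace Ω] {μ : Measure Ω} [IsProbabilityMeasure μ]
  {F : Type*} [NormedAddCommGroup F] [InnerProductSpace ℝ F] [FiniteDimensional ℝ F]
  [MeasurableSpace F] [BorelSpace F] {V : Ω → F} {Y : ℕ → Ω → F}

/-- The strong law gives convergence in probability; any constant below `1` could replace `1 / 2`.
The bound uses `n + 1` because the `n` increments here are joined by one large increment in the
lower bound. -/
theorem eventually_half_le_measureReal_norm_sum_le (hV : Integrable V μ)
    (hV0 : ∫ ω, V ω ∂μ = 0) (hY : iIndepFun Y μ)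
    (hYV : ∀ i, IdentDistrib (Y i) V μ μ) {ε : ℝ} (hε : 0 < ε) :
    ∀ᶠ n : ℕ in atTop, 1 / 2 ≤ μ.real {ω | ‖∑ i ∈ Finset.range n, Y i ω‖ ≤ ε * (n + 1)} := by
  have hint : ∀ i, Integrable (Y i) μ := fun i => (hYV i).integrable_iff.2 hV
  have hlaw := strong_law_ae Y (hint 0) (fun i j hij => hY.indepFun hij)
    fun i => (hYV i).trans (hYV 0).symm
  rw [(hYV 0).integral_eq, hV0] at hlaw
  have hsm : ∀ n : ℕ, AEStronglyMeasurable (fun ω => ∑ i ∈ Finset.range n, Y i ω) μ := fun n =>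
    (integrable_finsetSum _ fun i _ => hint i).aestronglyMeasurable
  have hprob := tendstoInMeasure_of_tendsto_ae (fun n => (hsm n).const_smul ((n : ℝ)⁻¹)) hlaw
    (ENNReal.ofReal ε) (ENNReal.ofReal_pos.2 hε)
  have hhalf : (0 : ENNReal) < 2⁻¹ := by simp
  filter_upwards [hprob.eventually (eventually_le_nhds hhalf), eventually_gt_atTop 0]
    with n hn hn0
  have hn' : (0 : ℝ) < n := by exact_mod_cast hn0
  have hms : NullMeasurableSet {ω | ‖∑ i ∈ Finset.range n, Y i ω‖ ≤ ε * (n + 1)} μ :=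
    nullMeasurableSet_le (hsm n).norm.aemeasurable aemeasurable_const
  have hc : μ.real {ω | ‖∑ i ∈ Finset.range n, Y i ω‖ ≤ ε * (n + 1)}ᶜ ≤ 1 / 2 := by
    have : (1 : ℝ) / 2 = (2⁻¹ : ENNReal).toReal := by simp
    rw [this]
    refine ENNReal.toReal_mono (by simp) ((measure_mono ?_).trans hn)
    intro ω hω
    have hω' : ε * (n + 1) < ‖∑ i ∈ Finset.range n, Y i ω‖ := not_le.1 hω
    change ENNReal.ofReal ε ≤ edist _ _
    rw [edist_dist, dist_zero_right]
    apply ENNReal.ofReal_le_ofReal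
    rw [Pi.smul_apply, norm_smul, norm_inv, Real.norm_of_nonneg hn'.le, inv_mul_eq_div,
      le_div_iff₀ hn']
    linarith
  rw [probReal_compl_eq_one_sub₀ hms] at hc
  linarith

/-- If the last of `n + 1` increments has norm above `m' * r * (n + 1)` and the others sum to at
most `(m' * r - a) * (n + 1)` in norm, the whole sum exceeds `a * (n + 1)`. The two events are
independent, and the second has probability at least `1 / 2`. -/
theorem eventually_exp_le_measureReal_norm_sum_gt {β s m : ℝ} (hβ : 0 < β) (hs : 0 < s)
    (hm : 0 < m) (hV : Integrable V μ)
    (hV0 : ∫ ω, V ω ∂μ = 0)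
    (hlow : ∀ m', 0 < m' → m' < m → ∃ κ > 0, ∀ᶠ x : ℝ in atTop,
      κ * Real.exp (-(x / s) ^ β) ≤ μ.real {ω | m' * x < ‖V ω‖})
    (hY : iIndepFun Y μ) (hYV : ∀ i, IdentDistrib (Y i) V μ μ) {a : ℝ} (ha : 0 < a) {ρ : ℝ}
    (hρ : (a / m) ^ β < ρ) :
    ∀ᶠ n : ℕ in atTop, Real.exp (-(ρ * ((n : ℝ) / s) ^ β)) ≤
      μ.real {ω | a * n < ‖∑ i ∈ Finset.range n, Y i ω‖} := by
  have hcont : ContinuousAt (fun r : ℝ => r ^ β) (a / m) :=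
    continuousAt_id.rpow_const (Or.inr hβ.le)
  -- Choose `r > a / m` with `r ^ β < ρ`, then `m'` between `a / r` and `m`, so that the jump `m' *
  -- r` overshoots `a`.
  obtain ⟨r, hrρ, har⟩ := ((hcont.eventually (gt_mem_nhds hρ)).filter_mono nhdsWithin_le_nhds
    |>.and (self_mem_nhdsWithin : Set.Ioi (a / m) ∈ 𝓝[>] (a / m))).exists
  have hr0 : 0 < r := (div_pos ha hm).trans har
  obtain ⟨m', hm'a, hm'm⟩ := exists_between ((div_lt_comm₀ hm hr0).1 har)
  have hm'0 : 0 < m' := (div_pos ha hr0).trans hm'a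
  have ham' : 0 < m' * r - a := sub_pos.2 ((div_lt_iff₀ hr0).1 hm'a)
  obtain ⟨κ, hκ, hbig⟩ := hlow m' hm'0 hm'm
  have hlaw := eventually_half_le_measureReal_norm_sum_le hV hV0 hY hYV ham'
  have hto : Tendsto (fun n : ℕ => r * ((n : ℝ) + 1)) atTop atTop :=
    (tendsto_atTop_add_const_right _ _ tendsto_natCast_atTop_atTop).const_mul_atTop hr0
  have hmain : ∀ᶠ n : ℕ in atTop, κ / 2 * Real.exp (-(r ^ β * (((n + 1 : ℕ) : ℝ) / s) ^ β)) ≤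
      μ.real {ω | a * (n + 1 : ℕ) < ‖∑ i ∈ Finset.range (n + 1), Y i ω‖} := by
    filter_upwards [hlaw, hto.eventually hbig] with n hn1 hn2
    push_cast
    have hind : IndepFun (∑ j ∈ Finset.range n, Y j) (Y n) μ :=
      hY.indepFun_finsetSum_of_notMem₀ (fun i => (hYV i).aemeasurable_fst) Finset.notMem_range_self
    have hprod := hind.measure_inter_preimage_eq_mul
      (Metric.closedBall 0 ((m' * r - a) * (n + 1))) {x | m' * (r * (n + 1)) < ‖x‖}
      measurableSet_closedBall (measurableSet_lt measurable_const measurable_norm)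
    have hn2' : μ.real {ω | m' * (r * (n + 1)) < ‖V ω‖} =
        μ.real (Y n ⁻¹' {x | m' * (r * (n + 1)) < ‖x‖}) := by
      unfold Measure.real
      congr 1
      exact ((hYV n).measure_mem_eq (measurableSet_lt measurable_const measurable_norm)).symm
    have hn1' : {ω | ‖∑ i ∈ Finset.range n, Y i ω‖ ≤ (m' * r - a) * (n + 1)} =
        (∑ j ∈ Finset.range n, Y j) ⁻¹' Metric.closedBall 0 ((m' * r - a) * (n + 1)) := by
      ext ω; simp
    rw [hn2'] at hn2
    rw [hn1'] at hn1
    have hre : κ / 2 * Real.exp (-(r ^ β * (((n : ℝ) + 1) / s) ^ β)) ≤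
        μ.real ((∑ j ∈ Finset.range n, Y j) ⁻¹' Metric.closedBall 0 ((m' * r - a) * (n + 1)) ∩
          Y n ⁻¹' {x | m' * (r * (n + 1)) < ‖x‖}) := by
      have e : (r * ((n : ℝ) + 1) / s) ^ β = r ^ β * (((n : ℝ) + 1) / s) ^ β := by
        rw [mul_div_assoc, Real.mul_rpow hr0.le (by positivity)]
      rw [e] at hn2
      rw [Measure.real, hprod, ENNReal.toReal_mul]
      calc _ = 1 / 2 * (κ * Real.exp (-(r ^ β * (((n : ℝ) + 1) / s) ^ β))) := by ring
        _ ≤ _ := mul_le_mul hn1 hn2 (by positivity) measureReal_nonneg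
    refine hre.trans (measureReal_mono ?_)
    rintro ω ⟨h1, h2⟩
    simp only [Set.mem_preimage, Finset.sum_apply, mem_closedBall_zero_iff,
      Set.mem_ofPred_eq] at h1 h2
    rw [Set.mem_ofPred_eq]
    rw [Finset.sum_range_succ]
    have := norm_sub_le (∑ i ∈ Finset.range n, Y i ω + Y n ω) (∑ i ∈ Finset.range n, Y i ω)
    rw [add_sub_cancel_left] at this
    nlinarith
  have hexp := eventually_const_mul_exp_le_exp hβ hs (2 / κ) hrρ
  rw [← map_add_atTop_eq_nat 1, eventually_map] at hexp ⊢
  filter_upwards [hmain, hexp] with n hn hn2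
  refine le_trans ?_ hn
  have h1 : Real.exp (-(ρ * (((n + 1 : ℕ) : ℝ) / s) ^ β)) ≤
      (((n + 1 : ℕ) : ℝ) + 1) * Real.exp (-(ρ * (((n + 1 : ℕ) : ℝ) / s) ^ β)) :=
    le_mul_of_one_le_left (Real.exp_pos _).le (le_add_of_nonneg_left (Nat.cast_nonneg _))
  refine h1.trans ?_
  calc _ = κ / 2 * (2 / κ * (((n + 1 : ℕ) : ℝ) + 1) *
        Real.exp (-(ρ * (((n + 1 : ℕ) : ℝ) / s) ^ β))) := by field_simp
    _ ≤ _ := by gcongr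

end LowerBound

theorem tendsto_log_div_of_exp_bounds {p w : ℕ → ℝ} {l : ℝ} (hw : Tendsto w atTop atTop)
    (hup : ∀ ρ < l, ∀ᶠ n in atTop, p n ≤ Real.exp (-(ρ * w n)))
    (hlo : ∀ ρ > l, ∀ᶠ n in atTop, Real.exp (-(ρ * w n)) ≤ p n) :
    Tendsto (fun n => Real.log (p n) / w n) atTop (𝓝 (-l)) := by
  have hpos : ∀ᶠ n in atTop, 0 < p n :=
    (hlo (l + 1) (by linarith)).mono fun n hn => (Real.exp_pos _).trans_le hn
  refine tendsto_order.2 ⟨fun b hb => ?_, fun b hb => ?_⟩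
  · obtain ⟨ρ, hρ, hρb⟩ := exists_between (show l < -b by linarith)
    filter_upwards [hlo ρ hρ, hpos, hw.eventually_gt_atTop 0] with n hn hp hw0
    rw [lt_div_iff₀ hw0]
    have := (Real.le_log_iff_exp_le hp).2 hn
    nlinarith
  · obtain ⟨ρ, hρb, hρ⟩ := exists_between (show -b < l by linarith)
    filter_upwards [hup ρ hρ, hpos, hw.eventually_gt_atTop 0] with n hn hp hw0
    rw [div_lt_iff₀ hw0]
    have := (Real.log_le_iff_le_exp hp).2 hn
    nlinarith

/-! ### Geometry of the ellipsoid -/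

section Ellipsoid

theorem toEuclideanLin_apply_of_isDiag {d : ℕ} {A : Matrix (Fin d) (Fin d) ℝ} (hA : A.IsDiag)
    (x : EuclideanSpace ℝ (Fin d)) (i : Fin d) :
    Matrix.toEuclideanLin A x i = A i i * x i := by
  rw [← hA.diagonal_diag]
  simp [Matrix.toEuclideanLin, Matrix.toLpLin_apply, Matrix.mulVec_diagonal]

theorem isClosed_ellipsoid {d : ℕ} (A : Matrix (Fin d) (Fin d) ℝ) : IsClosed (ellipsoid A) :=
  ((isCompact_sphere _ _).image
    (Matrix.toEuclideanLin A).continuous_of_finiteDimensional).isClosed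

theorem mem_ellipsoid_of_sum_eq_one {d : ℕ} {A : Matrix (Fin d) (Fin d) ℝ} (hA : A.IsDiag)
    (hA_pos : ∀ k, 0 < A k k) {x : EuclideanSpace ℝ (Fin d)}
    (hx : ∑ i, (x i / A i i) ^ 2 = 1) : x ∈ ellipsoid A := by
  refine ⟨WithLp.toLp 2 fun i => x i / A i i, ?_, ?_⟩
  · rw [mem_sphere_zero_iff_norm, EuclideanSpace.norm_eq]
    simp only [Real.norm_eq_abs, sq_abs]
    rw [hx, Real.sqrt_one]
  · ext i
    rw [toEuclideanLin_apply_of_isDiag hA]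
    simp [mul_div_cancel₀ _ (hA_pos i).ne']

theorem norm_le_of_mem_ellipsoid {d : ℕ} {A : Matrix (Fin d) (Fin d) ℝ} (hA : A.IsDiag)
    (hA_pos : ∀ k, 0 < A k k) {m : ℝ} (hm : 0 ≤ m) (hAm : ∀ k, A k k ≤ m)
    {x : EuclideanSpace ℝ (Fin d)} (hx : x ∈ ellipsoid A) : ‖x‖ ≤ m := by
  obtain ⟨u, hu, rfl⟩ := hx
  rw [mem_sphere_zero_iff_norm] at hu
  have h1 : ‖Matrix.toEuclideanLin A u‖ ^ 2 ≤ (m * ‖u‖) ^ 2 := by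
    rw [mul_pow, EuclideanSpace.real_norm_sq_eq, EuclideanSpace.real_norm_sq_eq, Finset.mul_sum]
    refine Finset.sum_le_sum fun i _ => ?_
    rw [toEuclideanLin_apply_of_isDiag hA, mul_pow]
    have := (hA_pos i).le
    have := hAm i
    gcongr
  have := abs_le_of_sq_le_sq h1 (by positivity)
  rw [hu, mul_one] at this
  exact (abs_le.1 (by simpa using this)).2

/-- A set that contains a graph over an open set of a coordinate hyperplane has positive
surface measure. -/
theorem hausdorffMeasure_pos_of_section {k : ℕ} (j : Fin (k + 1))
    {S : Set (EuclideanSpace ℝ (Fin (k + 1)))} {g : (Fin k → ℝ) → EuclideanSpace ℝ (Fin (k + 1))}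
    {U : Set (Fin k → ℝ)} {y₀ : Fin k → ℝ} (hU : U ∈ 𝓝 y₀) (hgS : ∀ y ∈ U, g y ∈ S)
    (hg : ∀ y ∈ U, ∀ i, g y (j.succAbove i) = y i) :
    0 < Measure.hausdorffMeasure (k : ℝ) S := by
  set p : EuclideanSpace ℝ (Fin (k + 1)) → (Fin k → ℝ) := fun x i => x (j.succAbove i) with hp
  have hlip : LipschitzWith 1 p := by
    refine LipschitzWith.of_dist_le_mul fun x y => ?_
    rw [NNReal.coe_one, one_mul, dist_pi_le_iff dist_nonneg]
    intro i
    rw [dist_eq_norm, dist_eq_norm]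
    exact PiLp.norm_apply_le (x - y) (j.succAbove i)
  have hUp : U ⊆ p '' S := fun y hy => ⟨g y, hgS y hy, funext fun i => hg y hy i⟩
  have hvol : 0 < (volume : Measure (Fin k → ℝ)) U := Measure.measure_pos_of_mem_nhds _ hU
  have hk : (Measure.hausdorffMeasure (k : ℝ) : Measure (Fin k → ℝ)) = volume := by
    simpa using hausdorffMeasure_pi_real (ι := Fin k)
  rw [← hk] at hvol
  have := hlip.hausdorffMeasure_image_le (Nat.cast_nonneg k) S
  rw [ENNReal.coe_one, ENNReal.one_rpow, one_mul] at this
  exact hvol.trans_le ((measure_mono hUp).trans this)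

/-- Near its vertex on the `j`-th axis the ellipsoid is a graph over the other coordinates, with `x
j = A j j * √(1 - f y)`; small `y` keep the graph inside `O`. -/
theorem hausdorffMeasure_ellipsoid_inter_pos {d : ℕ} {A : Matrix (Fin d) (Fin d) ℝ}
    (hA : A.IsDiag) (hA_pos : ∀ k, 0 < A k k) (j : Fin d)
    {O : Set (EuclideanSpace ℝ (Fin d))} (hO : IsOpen O)
    (hjO : EuclideanSpace.single j (A j j) ∈ O) :
    0 < Measure.hausdorffMeasure ((d : ℝ) - 1) (ellipsoid A ∩ O) := by
  obtain _ | k := d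
  · exact j.elim0
  rw [Nat.cast_succ, add_sub_cancel_right]
  set f : (Fin k → ℝ) → ℝ := fun y => ∑ i, (y i / A (j.succAbove i) (j.succAbove i)) ^ 2 with hf
  set g : (Fin k → ℝ) → EuclideanSpace ℝ (Fin (k + 1)) := fun y =>
    WithLp.toLp 2 (j.insertNth (A j j * √(1 - f y)) y) with hg
  have hfc : Continuous f := by fun_prop
  have hgc : Continuous g := by
    refine (PiLp.continuous_toLp 2 _).comp ?_
    exact Continuous.finInsertNth j (by fun_prop) continuous_id
  have hf0 : f 0 = 0 := by simp [hf]
  have hg0 : g 0 = EuclideanSpace.single j (A j j) := by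
    ext i
    refine Fin.succAboveCases j ?_ (fun i => ?_) i
    · simp [hg, hf0]
    · simp [hg]
  have hU : g ⁻¹' O ∩ f ⁻¹' Set.Iio 1 ∈ 𝓝 (0 : Fin k → ℝ) := by
    refine ((hO.preimage hgc).inter (isOpen_Iio.preimage hfc)).mem_nhds ⟨?_, ?_⟩
    · rwa [Set.mem_preimage, hg0]
    · simp [hf0]
  refine hausdorffMeasure_pos_of_section j hU (fun y hy => ⟨?_, hy.1⟩) fun y _ i => ?_
  · refine mem_ellipsoid_of_sum_eq_one hA hA_pos ?_
    have hy1 : f y < 1 := hy.2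
    rw [Fin.sum_univ_succAbove _ j]
    simp only [hg, Fin.insertNth_apply_same, Fin.insertNth_apply_succAbove]
    rw [mul_div_cancel_left₀ _ (hA_pos j).ne', Real.sq_sqrt (by linarith)]
    simp [hf]
  · simp [hg]

end Ellipsoid

/-! ### Large deviation rate for linear images of the walk -/

section Radial

variable {Ω : Type*} [MeasurableSpace Ω] {μ : Measure Ω} [IsProbabilityMeasure μ]
  {d : ℕ} {A : Matrix (Fin d) (Fin d) ℝ} {R : Ω → ℝ} {β s : ℝ}
  {Θ : Ω → EuclideanSpace ℝ (Fin d)}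

/-- The directions with `‖T x‖ > m` form a relatively open part of the ellipsoid around the vertex,
charged by `Θ`. By asymptotic independence, given `R > x` they keep at least half of their
probability for large `x`; this half is `κ`. -/
theorem IsAsympIndepOn.exists_mul_exp_le_measureReal (hA : A.IsDiag) (hA_pos : ∀ k, 0 < A k k)
    (hR : Measurable R) (hRW : IsWeibull μ R β s) (hRΘ : IsAsympIndepOn μ R Θ (ellipsoid A))
    (T : EuclideanSpace ℝ (Fin d) →L[ℝ] EuclideanSpace ℝ (Fin d)) (j : Fin d) {m : ℝ}
    (hm0 : 0 < m) (hm : m < ‖T (EuclideanSpace.single j (A j j))‖) :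
    ∃ κ > 0, ∀ᶠ x : ℝ in atTop,
      κ * Real.exp (-(x / s) ^ β) ≤ μ.real {ω | m * x < ‖T (R ω • Θ ω)‖} := by
  have hO : IsOpen {x : EuclideanSpace ℝ (Fin d) | m < ‖T x‖} :=
    isOpen_lt continuous_const T.continuous.norm
  set S := ellipsoid A ∩ {x | m < ‖T x‖} with hS
  have hSm : MeasurableSet S := (isClosed_ellipsoid A).measurableSet.inter hO.measurableSet
  have hSpos := hausdorffMeasure_ellipsoid_inter_pos hA hA_pos j hO hm
  have hpos := hRΘ.pos S Set.inter_subset_left hSm hSpos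
  have hlim := hRΘ.asymp_indep S Set.inter_subset_left hSm hSpos
  have hreal := (ENNReal.tendsto_toReal (measure_ne_top _ _)).comp hlim
  have hp : 0 < (μ (Θ ⁻¹' S)).toReal := ENNReal.toReal_pos hpos.ne' (measure_ne_top _ _)
  refine ⟨(μ (Θ ⁻¹' S)).toReal / 2, by positivity, ?_⟩
  filter_upwards [hreal.eventually (lt_mem_nhds (half_lt_self hp)), eventually_ge_atTop 0]
    with x hx hx0
  rw [Function.comp_apply, cond_apply (measurableSet_lt measurable_const hR), ENNReal.toReal_mul,
    ENNReal.toReal_inv] at hx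
  change _ < (μ.real {ω | x < R ω})⁻¹ * μ.real _ at hx
  rw [hRW.measureReal_lt hx0, inv_mul_eq_div, lt_div_iff₀ (Real.exp_pos _)] at hx
  refine hx.le.trans (measureReal_mono ?_)
  rintro ω ⟨h1, -, h2⟩
  have h1' : x < R ω := h1
  have h2' : m < ‖T (Θ ω)‖ := h2
  have hR0 : 0 < R ω := hx0.trans_lt h1'
  rw [Set.mem_ofPred_eq, map_smul, norm_smul, Real.norm_of_nonneg hR0.le]
  nlinarith

/-- The large deviation rate of a linear image of the random walk. -/
theorem tendsto_log_exceedProb (hA : A.IsDiag) (hA_pos : ∀ k, 0 < A k k)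
    (hR : Measurable R) (hβ : β ∈ Set.Ioo (0 : ℝ) 1) (hs : 0 < s) (hRW : IsWeibull μ R β s)
    (hRΘ : IsAsympIndepOn μ R Θ (ellipsoid A))
    {X : ℕ → Ω → EuclideanSpace ℝ (Fin d)} (hX_indep : iIndepFun X μ)
    (hX : ∀ i, IdentDistrib (X i) (fun ω => R ω • Θ ω) μ μ)
    (M : Matrix (Fin d) (Fin d) ℝ) {m : ℝ} (hm : 0 < m)
    (hMm : ∀ x ∈ ellipsoid A, ‖Matrix.toEuclideanLin M x‖ ≤ m) (j : Fin d)
    (hj : ‖Matrix.toEuclideanLin M (EuclideanSpace.single j (A j j))‖ = m)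
    {a : ℝ} (ha : 0 < a) :
    (∀ᶠ n : ℕ in atTop, 0 < exceedProb μ X M a n) ∧
    Tendsto (fun n : ℕ => Real.log (exceedProb μ X M a n) / ((n : ℝ) / s) ^ β) atTop
      (𝓝 (-(a / m) ^ β)) := by
  set T : EuclideanSpace ℝ (Fin d) →L[ℝ] EuclideanSpace ℝ (Fin d) :=
    LinearMap.toContinuousLinearMap (Matrix.toEuclideanLin M) with hT
  have hTM : ∀ x, Matrix.toEuclideanLin M x = T x := fun x => rfl
  have hTm : Measurable T := T.continuous.measurable
  have hV : Integrable (fun ω => T (R ω • Θ ω)) μ := T.integrable_comp hRΘ.integrable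
  have hV0 : ∫ ω, T (R ω • Θ ω) ∂μ = 0 := by
    rw [T.integral_comp_comm hRΘ.integrable, hRΘ.mean_zero, map_zero]
  have hVR : ∀ᵐ ω ∂μ, ‖T (R ω • Θ ω)‖ ≤ m * R ω := by
    filter_upwards [hRΘ.mem, hRW.ae_pos hR hβ.1] with ω hω hR0
    rw [map_smul, norm_smul, Real.norm_of_nonneg hR0.le, mul_comm]
    gcongr
    exact hMm _ hω
  have hY : iIndepFun (fun i ω => T (X i ω)) μ := hX_indep.comp (fun _ => T) fun _ => hTm
  have hYV : ∀ i, IdentDistrib (fun ω => T (X i ω)) (fun ω => T (R ω • Θ ω)) μ μ :=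
    fun i => (hX i).comp hTm
  have heq : ∀ᶠ n : ℕ in atTop,
      μ.real {ω | a * n < ‖∑ i ∈ Finset.range n, T (X i ω)‖} = exceedProb μ X M a n := by
    filter_upwards [eventually_gt_atTop 0] with n hn
    have hn' : (0 : ℝ) < n := by exact_mod_cast hn
    unfold exceedProb randomWalk
    congr 1
    ext ω
    simp only [Set.mem_ofPred_eq]
    rw [hTM, map_smul, norm_smul, norm_inv, Real.norm_of_nonneg hn'.le, inv_mul_eq_div,
      lt_div_iff₀ hn', map_sum]
  have hlo : ∀ ρ > (a / m) ^ β, ∀ᶠ n : ℕ in atTop,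
      Real.exp (-(ρ * ((n : ℝ) / s) ^ β)) ≤ exceedProb μ X M a n := by
    intro ρ hρ
    have := eventually_exp_le_measureReal_norm_sum_gt hβ.1 hs hm hV hV0
      (fun m' hm' hm'm => hRΘ.exists_mul_exp_le_measureReal hA hA_pos hR hRW T j hm'
        (hm'm.trans_eq hj.symm)) hY hYV ha hρ
    filter_upwards [this, heq] with n h1 h2
    rwa [← h2]
  have hup : ∀ ρ < (a / m) ^ β, ∀ᶠ n : ℕ in atTop,
      exceedProb μ X M a n ≤ Real.exp (-(ρ * ((n : ℝ) / s) ^ β)) := by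
    intro ρ hρ
    filter_upwards [hRW.eventually_measureReal_norm_sum_gt_le hR hβ hs hm hV hV0 hVR hY hYV ha hρ,
      heq] with n h1 h2
    rwa [← h2]
  exact ⟨(hlo _ (lt_add_one _)).mono fun n hn => (Real.exp_pos _).trans_le hn,
    tendsto_log_div_of_exp_bounds (tendsto_div_rpow_atTop hβ.1 hs) hup hlo⟩

end Radial

/-! ### Comparison of the two rates -/

theorem inv_eq_diagonal_of_isDiag {d : ℕ} {A : Matrix (Fin d) (Fin d) ℝ} (hA : A.IsDiag)
    (hA_pos : ∀ k, 0 < A k k) : A⁻¹ = Matrix.diagonal fun i => (A i i)⁻¹ := by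
  refine Matrix.inv_eq_right_inv ?_
  nth_rw 1 [← hA.diagonal_diag]
  rw [Matrix.diagonal_mul_diagonal, ← Matrix.diagonal_one]
  congr 1
  ext i
  exact mul_inv_cancel₀ (hA_pos i).ne'

theorem mainTheorem5 {Ω : Type*} [MeasurableSpace Ω] (μ : Measure Ω) [IsProbabilityMeasure μ]
    (d : ℕ) (hd : 1 ≤ d)
    (A : Matrix (Fin d) (Fin d) ℝ) (hA : A.IsDiag) (hA_pos : ∀ k, 0 < A k k)
    (R : Ω → ℝ) (hR : Measurable R)
    (β s : ℝ) (hβ : β ∈ Set.Ioo (0 : ℝ) 1) (hs : 0 < s) (hRW : IsWeibull μ R β s)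
    (Θ : Ω → EuclideanSpace ℝ (Fin d)) (hΘ : Measurable Θ)
    (hRΘ : IsAsympIndepOn μ R Θ (ellipsoid A))
    (X : ℕ → Ω → EuclideanSpace ℝ (Fin d)) (hX_indep : iIndepFun X μ)
    (hX : ∀ i, IdentDistrib (X i) (fun ω => R ω • Θ ω) μ μ)
    -- any admissible scale function, for example `h x = (x / s) ^ β`
    (h : ℝ → ℝ)
    (hh : Tendsto (fun x : ℝ => -Real.log (μ.real {ω | x < R ω}) / h x) atTop (𝓝 1))
    (a : ℝ) (ha : 0 < a) (c : ℝ) (hc : ∀ j, 1 / A j j < c)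
    (Q : Matrix (Fin d) (Fin d) ℝ) (hQ : Q = 1 - c⁻¹ • A⁻¹) :
    IsReinsurerStrategy Q ∧
    -- the logarithms are eventually those of positive numbers
    (∀ᶠ n : ℕ in atTop, 0 < exceedProb μ X 1 a n ∧ 0 < exceedProb μ X (1 - Q) a n) ∧
    ∃ L L_Q : ℝ,
      Tendsto (fun n : ℕ => Real.log (exceedProb μ X 1 a n) / h n) atTop (𝓝 L) ∧
      Tendsto (fun n : ℕ => Real.log (exceedProb μ X (1 - Q) a n) / h n) atTop (𝓝 L_Q) ∧
      L_Q < L := by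
  have hinv := inv_eq_diagonal_of_isDiag hA hA_pos
  have : Nonempty (Fin d) := ⟨⟨0, hd⟩⟩
  obtain ⟨j, hj⟩ := Finite.exists_max fun k => A k k
  have hc0 : 0 < c := (one_div_pos.2 (hA_pos j)).trans (hc j)
  have hM : 1 - Q = c⁻¹ • A⁻¹ := by rw [hQ, sub_sub_cancel]
  have hQdiag : Q = Matrix.diagonal fun i => 1 - c⁻¹ * (A i i)⁻¹ := by
    rw [hQ, hinv, ← Matrix.diagonal_one, ← Matrix.diagonal_smul, Matrix.diagonal_sub]
    rfl
  -- As `(1 - Q) A = c⁻¹ I`, the ellipsoid is mapped to the sphere of radius `c⁻¹`. Every direction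
  -- is then extremal, so the vertex `j` serves for both rates.
  have hnormM : ∀ x ∈ ellipsoid A, ‖Matrix.toEuclideanLin (1 - Q) x‖ = c⁻¹ := by
    rintro _ ⟨u, hu, rfl⟩
    have : Matrix.toEuclideanLin (1 - Q) (Matrix.toEuclideanLin A u) = c⁻¹ • u := by
      have hdiag : (1 - Q).IsDiag := by
        rw [hM, hinv]
        exact (Matrix.isDiag_diagonal _).smul _
      ext i
      rw [toEuclideanLin_apply_of_isDiag hdiag, toEuclideanLin_apply_of_isDiag hA, hM, hinv]
      have := (hA_pos i).ne'
      simp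
      field_simp
    rw [mem_sphere_zero_iff_norm] at hu
    rw [this, norm_smul, hu, mul_one, Real.norm_of_nonneg (inv_nonneg.2 hc0.le)]
  have hsingle : EuclideanSpace.single j (A j j) ∈ ellipsoid A := by
    refine ⟨EuclideanSpace.single j 1, by simp, ?_⟩
    ext i
    rw [toEuclideanLin_apply_of_isDiag hA]
    rcases eq_or_ne i j with rfl | hij
    · simp
    · simp [hij]
  obtain ⟨hpos1, hlim1⟩ := tendsto_log_exceedProb hA hA_pos hR hβ hs hRW hRΘ hX_indep hX 1
    (hA_pos j) (fun x hx => by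
      rw [Matrix.toEuclideanLin, Matrix.toLpLin_one]
      exact norm_le_of_mem_ellipsoid hA hA_pos (hA_pos j).le hj hx) j
    (by
      rw [Matrix.toEuclideanLin, Matrix.toLpLin_one]
      simp [abs_of_pos (hA_pos j)]) ha
  obtain ⟨hpos2, hlim2⟩ := tendsto_log_exceedProb hA hA_pos hR hβ hs hRW hRΘ hX_indep hX (1 - Q)
    (inv_pos.2 hc0) (fun x hx => (hnormM x hx).le) j (hnormM _ hsingle) ha
  -- The Weibull tail has exact logarithm `-(x / s) ^ β`, so `hh` along the integers allows the
  -- scale to be exchanged.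
  have hscale : Tendsto (fun n : ℕ => ((n : ℝ) / s) ^ β / h n) atTop (𝓝 1) := by
    refine (hh.comp tendsto_natCast_atTop_atTop).congr fun n => ?_
    rw [Function.comp_apply, hRW.measureReal_lt n.cast_nonneg, Real.log_exp, neg_neg]
  have htrans : ∀ (p : ℕ → ℝ) (l : ℝ),
      Tendsto (fun n : ℕ => Real.log (p n) / ((n : ℝ) / s) ^ β) atTop (𝓝 l) →
      Tendsto (fun n : ℕ => Real.log (p n) / h n) atTop (𝓝 l) := by
    intro p l hp
    have := hp.mul hscale
    rw [mul_one] at this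
    refine this.congr' ?_
    filter_upwards [eventually_gt_atTop 0] with n hn
    have hn' : (0 : ℝ) < n := by exact_mod_cast hn
    exact div_mul_div_cancel₀ (by positivity)
  refine ⟨⟨hQdiag ▸ Matrix.isDiag_diagonal _, fun i => ?_⟩, hpos1.and hpos2, _, _,
    htrans _ _ hlim1, htrans _ _ hlim2, neg_lt_neg ?_⟩
  · have hci : (A i i)⁻¹ < c := by simpa using hc i
    have h1 : c⁻¹ * (A i i)⁻¹ < 1 := by rwa [inv_mul_lt_one₀ hc0]
    have h2 : 0 < c⁻¹ * (A i i)⁻¹ := mul_pos (inv_pos.2 hc0) (inv_pos.2 (hA_pos i))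
    rw [hQdiag, Matrix.diagonal_apply_eq]
    constructor <;> linarith
  -- The limits are `-(a / A j j) ^ β` and `-(a * c) ^ β`, and `1 / A j j < c` separates them.
  · have hcj : (A j j)⁻¹ < c := by simpa using hc j
    refine Real.rpow_lt_rpow (div_nonneg ha.le (hA_pos j).le) ?_ hβ.1
    rw [div_inv_eq_mul, div_eq_mul_inv]
    gcongr
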